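/- Let $E,\tilde E$ be metric spaces (for instance Euclidean spaces) and let $N\ge 0$. A pair of point clouds is a pair of tuples $X=(X_1,\dots,X_N)\in E^N$, $\tilde X=(\tilde X_1,\dots,\tilde X_N)\in\tilde E^N$, with distance matrices $w_{ij}=d(X_i,X_j)$ and $\tilde w_{ij}=d(\tilde X_i,\tilde X_j)$. Let $w_+$ be the matrix $w$ with its entries strictly below the diagonal replaced by $+\infty$, and let $\hat{\mathcal G}^{w,\tilde w}$ be the graph on $2N$ vertices with matrix of edge weights $$m=\begin{pmatrix}0&(w_+)^{\top}\\ w_+&\min(w,\tilde w)\end{pmatrix}.$$ For $\alpha\in\mathbb R$ let $\mathrm{VR}_\alpha$ be the simplicial complex of the sets $\sigma$ of vertices with $m_{ij}\le\alpha$ for all $i,j\in\sigma$. For $k\ge 0$ let $\text{R-Cross-Barcode}_k(X,\tilde X)$ be the barcode of the persistence module $\alpha\mapsto H_k(\mathrm{VR}_\alpha;\mathbb Z/2)$ (reduced homology, which matters only for $k=0$), i.e. the multiset of intervals $[b,d)$, $b<d\le+\infty$, in which the multiplicity of $[b,d)$ is the dimension of the space of classes in $H_k(\mathrm{VR}_b)$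 that vanish in $H_k(\mathrm{VR}_d)$ (all classes if $d=+\infty$), modulo the subspace spanned by those among them that come from some $H_k(\mathrm{VR}_s)$ with $s<b$ and those that already vanish in some $H_k(\mathrm{VR}_t)$ with $b\le t<d$. Let $\mathrm{RTD}_k(X,\tilde X)\in[0,\infty]$ be the sum of the lengths $d-b$ of these intervals, counted with multiplicity, and let $\mathrm{RTD}(X,\tilde X)=\tfrac12\big(\mathrm{RTD}_1(X,\tilde X)+\mathrm{RTD}_1(\tilde X,X)\big)$. Then, for every $k\ge 0$, $\mathrm{RTD}_k(X,\tilde X)$ is finite for all $X,\tilde X$, and $(X,\tilde X)\mapsto\mathrm{RTD}_k(X,\tilde X)$ is continuous on $E^N\times\tilde E^N$. In particular the RTD loss $(X,\tilde X)\mapsto\mathrm{RTD}(X,\tilde X)$ is continuous. -/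

import Mathlib

open CategoryTheory
open scoped ENNReal

noncomputable section

namespace RTD

/-! ### Vietoris-Rips filtration of a weighted graph and its homology modulo 2 -/

/-- Simplices of the Vietoris-Rips complex `VR_α` of a graph with edge weights `m`
(weight `⊤` means `+∞`): the finite sets of vertices with all weights at most `α`.
The empty set is included as the simplex of dimension `-1`, so that the homology below is
the reduced one; this only affects degree `0`. -/
def vrSimplices {V : Type} (m : V → V → WithTop ℝ) (α : ℝ) : Set (Finset V) :=
  {σ | ∀ i ∈ σ, ∀ j ∈ σ, m i j ≤ (α : WithTop ℝ)}

theorem vrSimplices_mono {V : Type} (m : V → V → WithTop ℝ) {α β : ℝ} (h : α ≤ β) :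
    vrSimplices m α ⊆ vrSimplices m β :=
  fun _ hσ i hi j hj => (hσ i hi j hj).trans (WithTop.coe_le_coe.2 h)

/-- Formal combinations modulo 2 of the simplices of `VR_α` with `n` vertices
(that is, of dimension `n - 1`), inside the space of combinations of all sets of vertices.
A combination is identified with its family of coefficients. -/
def chains {V : Type} (m : V → V → WithTop ℝ) (n : ℕ) (α : ℝ) :
    Submodule (ZMod 2) (Finset V → ZMod 2) where
  carrier := {c | ∀ σ, ¬ (σ ∈ vrSimplices m α ∧ σ.card = n) → c σ = 0}
  zero_mem' := fun _ _ => rfl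
  add_mem' := fun {c c'} hc hc' σ hσ => by
    rw [Pi.add_apply, hc σ hσ, hc' σ hσ, add_zero]
  smul_mem' := fun a c hc σ hσ => by rw [Pi.smul_apply, hc σ hσ, smul_zero]

/-- The boundary operator: a simplex is sent to the sum of its facets. -/
def boundary (V : Type) [Fintype V] [DecidableEq V] :
    (Finset V → ZMod 2) →ₗ[ZMod 2] (Finset V → ZMod 2) :=
  Fintype.linearCombination (ZMod 2)
    (fun σ : Finset V => ∑ v ∈ σ, Pi.single (M := fun _ : Finset V => ZMod 2) (σ.erase v) 1)

/-- The `k`-cycles of `VR_α`. -/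
def cycles {V : Type} [Fintype V] [DecidableEq V] (m : V → V → WithTop ℝ) (k : ℕ) (α : ℝ) :
    Submodule (ZMod 2) (Finset V → ZMod 2) :=
  chains m (k + 1) α ⊓ LinearMap.ker (boundary V)

/-- The `k`-boundaries of `VR_α`: boundaries of `(k+1)`-chains. -/
def boundaries {V : Type} [Fintype V] [DecidableEq V] (m : V → V → WithTop ℝ) (k : ℕ) (α : ℝ) :
    Submodule (ZMod 2) (Finset V → ZMod 2) :=
  (chains m (k + 2) α).map (boundary V)

theorem chains_mono {V : Type} (m : V → V → WithTop ℝ) (n : ℕ) {α β : ℝ} (h : α ≤ β) :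
    chains m n α ≤ chains m n β :=
  fun _ hc σ hσ => hc σ fun hσ' => hσ ⟨vrSimplices_mono m h hσ'.1, hσ'.2⟩

theorem cycles_mono {V : Type} [Fintype V] [DecidableEq V] (m : V → V → WithTop ℝ) (k : ℕ) {α β : ℝ}
    (h : α ≤ β) : cycles m k α ≤ cycles m k β :=
  inf_le_inf_right _ (chains_mono m _ h)

theorem boundaries_mono {V : Type} [Fintype V] [DecidableEq V] (m : V → V → WithTop ℝ) (k : ℕ) {α β : ℝ}
    (h : α ≤ β) : boundaries m k α ≤ boundaries m k β :=
  Submodule.map_mono (chains_mono m _ h)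

/-- The homology group `H_k(VR_α)`: cycles modulo boundaries. -/
abbrev homology {V : Type} [Fintype V] [DecidableEq V] (m : V → V → WithTop ℝ) (k : ℕ) (α : ℝ) : Type :=
  cycles m k α ⧸ (boundaries m k α).submoduleOf (cycles m k α)

/-- The map `H_k(VR_α) → H_k(VR_β)` induced by the inclusion, for `α ≤ β`. -/
def homologyMap {V : Type} [Fintype V] [DecidableEq V] (m : V → V → WithTop ℝ) (k : ℕ) {α β : ℝ}
    (h : α ≤ β) : homology m k α →ₗ[ZMod 2] homology m k β :=
  Submodule.mapQ _ _ (Submodule.inclusion (cycles_mono m k h))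
    (fun _ hx => boundaries_mono m k h hx)

/-- The `k`-th persistent homology of the Vietoris-Rips filtration of a weighted graph. -/
def persistentHomology {V : Type} [Fintype V] [DecidableEq V] (m : V → V → WithTop ℝ) (k : ℕ) :
    ℝ ⥤ ModuleCat.{0} (ZMod 2) where
  obj α := ModuleCat.of (ZMod 2) (homology m k α)
  map f := ModuleCat.ofHom (homologyMap m k (leOfHom f))
  map_id α := by
    ext x
    rfl
  map_comp f g := by
    ext x
    rfl

/-! ### Barcodes -/

/-- The classes of `M_b` that come from thresholds strictly smaller than `b`. -/
def olderClasses (M : ℝ ⥤ ModuleCat.{0} (ZMod 2)) (b : ℝ) : Submodule (ZMod 2) (M.obj b) :=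
  ⨆ (s : ℝ) (h : s < b), LinearMap.range (M.map (homOfLE h.le)).hom

/-- The classes of `M_b` that vanish in `M_d`; all classes if `d = +∞`, none but `0` if
`d < b`. -/
def classesDeadAt (M : ℝ ⥤ ModuleCat.{0} (ZMod 2)) (b : ℝ) :
    WithTop ℝ → Submodule (ZMod 2) (M.obj b)
  | ⊤ => ⊤
  | (d : ℝ) => ⨆ h : b ≤ d, LinearMap.ker (M.map (homOfLE h)).hom

/-- The classes of `M_b` that vanish at some threshold strictly smaller than `d`. -/
def classesDeadBefore (M : ℝ ⥤ ModuleCat.{0} (ZMod 2)) (b : ℝ) (d : WithTop ℝ) :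
    Submodule (ZMod 2) (M.obj b) :=
  ⨆ (t : ℝ) (_ : (t : WithTop ℝ) < d), classesDeadAt M b t

/-- The barcode of a persistence module `M`, as a multiset of intervals `[b, d)` with
`b < d ≤ +∞` given by its multiplicity function. The multiplicity of `[b, d)` is the dimension
of the space of classes of `M_b` that are dead at `d`, modulo those which are born before `b`
and those which die before `d`. (If `M` is a direct sum of finitely many interval modules
supported on intervals `[b_i, d_i)`, this is the number of `i` with `[b_i, d_i) = [b, d)`.
If `d ≤ b` the multiplicity is `0`.) -/
def barcode (M : ℝ ⥤ ModuleCat.{0} (ZMod 2)) (I : ℝ × WithTop ℝ) : ℕ :=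
  Module.finrank (ZMod 2)
    (classesDeadAt M I.1 I.2 ⧸
      ((olderClasses M I.1 ⊓ classesDeadAt M I.1 I.2) ⊔
        classesDeadBefore M I.1 I.2).submoduleOf (classesDeadAt M I.1 I.2))

/-- The length `d - b` of the interval `[b, d)`. -/
def barLength : ℝ × WithTop ℝ → ℝ≥0∞
  | (_, ⊤) => ⊤
  | (b, (d : ℝ)) => ENNReal.ofReal (d - b)

/-- The sum of the lengths of the intervals of a barcode, with multiplicities. -/
def totalLength (B : ℝ × WithTop ℝ → ℕ) : ℝ≥0∞ :=
  ∑' I : ℝ × WithTop ℝ, (B I : ℝ≥0∞) * barLength I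

/-! ### R-Cross-Barcode and RTD -/

/-- The matrix of pairwise distances of a point cloud. -/
def distMatrix {N : ℕ} {E : Type*} [MetricSpace E] (X : Fin N → E) : Fin N → Fin N → ℝ :=
  fun i j => dist (X i) (X j)

/-- The matrix `w₊`: `w` with its entries below the diagonal replaced by `+∞`. -/
def upperPart {N : ℕ} (w : Fin N → Fin N → ℝ) (i j : Fin N) : WithTop ℝ :=
  if i ≤ j then (w i j : WithTop ℝ) else ⊤

/-- The weights of the graph with doubled set of vertices: the block matrix with rows
`(0, w₊ᵀ)` and `(w₊, min(w, w'))`. -/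
def doubledWeights {N : ℕ} (w w' : Fin N → Fin N → ℝ) :
    Fin N ⊕ Fin N → Fin N ⊕ Fin N → WithTop ℝ
  | .inl _, .inl _ => 0
  | .inl i, .inr j => upperPart w j i
  | .inr i, .inl j => upperPart w i j
  | .inr i, .inr j => ((min (w i j) (w' i j) : ℝ) : WithTop ℝ)

/-- `R-Cross-Barcode_k(X, Y)`. -/
def crossBarcode {N : ℕ} {E E' : Type*} [MetricSpace E] [MetricSpace E'] (k : ℕ)
    (X : Fin N → E) (Y : Fin N → E') : ℝ × WithTop ℝ → ℕ :=
  barcode (persistentHomology (doubledWeights (distMatrix X) (distMatrix Y)) k)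

/-- `RTD_k(X, Y)`: the sum of the lengths of the bars of `R-Cross-Barcode_k(X, Y)`. -/
def rtd {N : ℕ} {E E' : Type*} [MetricSpace E] [MetricSpace E'] (k : ℕ)
    (X : Fin N → E) (Y : Fin N → E') : ℝ≥0∞ :=
  totalLength (crossBarcode k X Y)

/-- The symmetrized loss `RTD(X, Y) = (RTD_1(X, Y) + RTD_1(Y, X)) / 2`. -/
def rtdLoss {N : ℕ} {E E' : Type*} [MetricSpace E] [MetricSpace E']
    (X : Fin N → E) (Y : Fin N → E') : ℝ≥0∞ :=
  (rtd 1 X Y + rtd 1 Y X) / 2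

end RTD

end

/-!
The total length of a barcode is the integral of the number of bars over a point `α`, and that
number is `dim M_α`. So `RTD_k` is the integral over `α` of `dim H_k(VR_α)`.

To count bars without a structure theorem, the multiplicity of `[b, d)` is written as the mixed
second difference of the function `(s, t) ↦ rank (M_s → M_t)` at `(b, d)`
(`ChangesOnlyAt.barcode_eq`). Summing over `b ≤ α < d` telescopes in both variables to
`rank (M_α → M_α)`, since `M` vanishes far to the left and far to the right
(`ChangesOnlyAt.sum_barcode_eq_finrank`); integration gives `ChangesOnlyAt.totalLength_barcode`.

For the doubled graph the homology vanishes for `α < 0`, as there are no vertices, and for `α` at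
least the diameter of `X`, as the complex is then a cone
(`subsingleton_homology_of_dist_le`). So the integral runs over a bounded interval, which gives
finiteness. For continuity, `dim H_k(VR_α)` is a difference of the dimensions of two subspaces of a
fixed finite-dimensional space, cycles and boundaries (`finrank_homology`), each increasing in `α`. If the distances
change by at most `ε`, both filtrations are `ε`-interleaved with the old ones, and the integral of
a bounded monotone function over a bounded interval changes by `O(ε)` under a shift by `ε`
(`integral_le_integral_add_of_shift`, `continuous_integral_finrank`).
-/

open MeasureTheory Module

namespace RTD

/-! ### Ranks of composites and telescoping sums -/

/-- Rank-nullity for the restriction of `g` to the range of `f`. -/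
theorem finrank_range_inf_ker_add {K U V W : Type*} [DivisionRing K]
    [AddCommGroup U] [Module K U] [AddCommGroup V] [Module K V] [AddCommGroup W] [Module K W]
    [FiniteDimensional K V] (f : U →ₗ[K] V) (g : V →ₗ[K] W) :
    finrank K ↥(LinearMap.range f ⊓ LinearMap.ker g) + finrank K (LinearMap.range (g ∘ₗ f)) =
      finrank K (LinearMap.range f) := by
  have h := (g.domRestrict (LinearMap.range f)).finrank_range_add_finrank_ker
  have h1 : LinearMap.range (g.domRestrict (LinearMap.range f)) = LinearMap.range (g ∘ₗ f) := by
    rw [LinearMap.range_domRestrict, LinearMap.range_comp]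
  have h2 : finrank K (LinearMap.ker (g.domRestrict (LinearMap.range f))) =
      finrank K ↥(LinearMap.range f ⊓ LinearMap.ker g) := by
    rw [LinearMap.ker_domRestrict, ← Submodule.map_comap_subtype]
    exact (LinearEquiv.finrank_eq
      (Submodule.equivMapOfInjective _ (LinearMap.range f).injective_subtype _))
  rw [h1, h2] at h
  omega

theorem exists_lt_forall_not_mem_Ico (F : Finset ℝ) (b : ℝ) :
    ∃ p < b, ∀ x ∈ F, ¬ (p ≤ x ∧ x < b) := by
  induction F using Finset.induction_on with
  | empty => exact ⟨b - 1, by linarith, by simp⟩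
  | insert a F _ ih =>
    obtain ⟨p, hpb, hp⟩ := ih
    by_cases hab : a < b
    · refine ⟨max p ((a + b) / 2), max_lt hpb (by linarith), ?_⟩
      intro x hx ⟨h1, h2⟩
      obtain rfl | hx := Finset.mem_insert.1 hx
      · have := (le_max_right _ _).trans h1
        linarith
      · exact hp x hx ⟨(le_max_left _ _).trans h1, h2⟩
    · refine ⟨p, hpb, ?_⟩
      intro x hx ⟨h1, h2⟩
      obtain rfl | hx := Finset.mem_insert.1 hx
      · exact hab h2
      · exact hp x hx ⟨h1, h2⟩

/-- A function which is constant between consecutive points of a finite set `F` changes between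
`s` and `t` by the sum of its jumps. Here `p b` is a point just before `b`, and constancy is only
required for arguments in `D`. -/
theorem sum_jumps_eq_sub (F : Finset ℝ) (p : ℝ → ℝ) (hpb : ∀ b, p b < b)
    (hp : ∀ b, ∀ x ∈ F, ¬ (p b ≤ x ∧ x < b)) (D : Set ℝ) (f : ℝ → ℤ)
    (hf : ∀ s ∈ D, ∀ t ∈ D, s ≤ t → (∀ x ∈ F, ¬ (s < x ∧ x ≤ t)) → f s = f t) (s t : ℝ)
    (hst : s ≤ t) (hs : s ∈ D) (ht : t ∈ D)
    (hD : ∀ b ∈ F, s < b → b ≤ t → b ∈ D ∧ p b ∈ D) :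
    ∑ b ∈ F with s < b ∧ b ≤ t, (f b - f (p b)) = f t - f s := by
  induction hn : ({b ∈ F | s < b ∧ b ≤ t} : Finset ℝ).card using Nat.strong_induction_on
    generalizing t with
  | _ n ih =>
  obtain hG | hG := ({b ∈ F | s < b ∧ b ≤ t} : Finset ℝ).eq_empty_or_nonempty
  · rw [hG, Finset.sum_empty, hf s hs t ht hst, sub_self]
    intro x hx h
    exact Finset.notMem_empty x (hG ▸ Finset.mem_filter.2 ⟨hx, h⟩)
  · obtain ⟨b, hb, hmax⟩ := Finset.exists_max_image _ id hG
    obtain ⟨hbF, hsb, hbt⟩ := Finset.mem_filter.1 hb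
    have hmax' : ∀ x ∈ F, s < x → x ≤ t → x ≤ b := fun x hx h1 h2 =>
      hmax x (Finset.mem_filter.2 ⟨hx, h1, h2⟩)
    have htb : f b = f t := hf b (hD b hbF hsb hbt).1 t ht hbt fun x hx h =>
      absurd (hmax' x hx (hsb.trans h.1) h.2) (not_le.2 h.1)
    have hpD := (hD b hbF hsb hbt).2
    have herase : ({x ∈ F | s < x ∧ x ≤ t} : Finset ℝ).erase b =
        {x ∈ F | s < x ∧ x ≤ p b} := by
      ext x
      simp only [Finset.mem_erase, Finset.mem_filter]
      constructor
      · rintro ⟨hne, hx, h1, h2⟩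
        refine ⟨hx, h1, ?_⟩
        by_contra hlt
        exact hp b x hx ⟨(not_le.1 hlt).le, lt_of_le_of_ne (hmax' x hx h1 h2) hne⟩
      · rintro ⟨hx, h1, h2⟩
        have := hpb b
        exact ⟨by linarith, hx, h1, by linarith⟩
    rw [← Finset.add_sum_erase _ _ hb, herase, htb]
    obtain hsp | hsp := le_total s (p b)
    · rw [ih _ (by rw [← hn, ← herase]; exact Finset.card_erase_lt_of_mem hb) (p b) hsp hpD
        (fun x hx h1 h2 => hD x hx h1 (h2.trans ((hpb b).le.trans hbt))) rfl]
      ring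
    · have hemp : ({x ∈ F | s < x ∧ x ≤ p b} : Finset ℝ) = ∅ :=
        Finset.filter_eq_empty_iff.2 fun x _ h => absurd (h.1.trans_le h.2) (not_lt.2 hsp)
      rw [hemp, Finset.sum_empty, hf (p b) hpD s hs hsp fun x hx h =>
        hp b x hx ⟨h.1.le, h.2.trans_lt hsb⟩, add_zero]

/-! ### Multiplicities as second differences of ranks -/

variable (M : ℝ ⥤ ModuleCat.{0} (ZMod 2))

/-- The structure map `M_s → M_t` of a persistence module, as a linear map. -/
abbrev structureMap {s t : ℝ} (h : s ≤ t) : M.obj s →ₗ[ZMod 2] M.obj t :=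
  (M.map (homOfLE h)).hom

theorem structureMap_comp {s t u : ℝ} (hst : s ≤ t) (htu : t ≤ u) :
    structureMap M htu ∘ₗ structureMap M hst = structureMap M (hst.trans htu) := by
  rw [structureMap, structureMap, structureMap, ← ModuleCat.hom_comp, ← M.map_comp]
  rfl

theorem structureMap_refl (s : ℝ) : structureMap M (le_refl s) = LinearMap.id := by
  have : homOfLE (le_refl s) = 𝟙 s := rfl
  rw [structureMap, this, M.map_id, ModuleCat.hom_id]

/-- The rank of the structure map `M_s → M_t`, and `0` unless `s ≤ t`. -/
noncomputable def structureRank (s t : ℝ) : ℤ :=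
  if h : s ≤ t then (finrank (ZMod 2) (LinearMap.range (structureMap M h)) : ℤ) else 0

theorem structureRank_of_le {s t : ℝ} (h : s ≤ t) :
    structureRank M s t = finrank (ZMod 2) (LinearMap.range (structureMap M h)) :=
  dif_pos h

theorem structureRank_self (s : ℝ) : structureRank M s s = finrank (ZMod 2) (M.obj s) := by
  rw [structureRank_of_le M le_rfl, structureMap_refl, LinearMap.range_id, finrank_top]

/-- The module `M` changes only at the thresholds in `F`: the structure map `M_s → M_t` is bijective
when no point of `F` lies in `(s, t]`. The choice of `(s, t]` makes `M` constant on intervals that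
contain their left endpoint, like the bars. -/
def ChangesOnlyAt (F : Finset ℝ) : Prop :=
  ∀ ⦃s t : ℝ⦄ (h : s ≤ t), (∀ x ∈ F, ¬ (s < x ∧ x ≤ t)) → Function.Bijective (structureMap M h)

variable {M} {F : Finset ℝ}

theorem ChangesOnlyAt.structureRank_left (hF : ChangesOnlyAt M F) {s s' t : ℝ} (h : s ≤ s')
    (ht : s' ≤ t) (hx : ∀ x ∈ F, ¬ (s < x ∧ x ≤ s')) :
    structureRank M s t = structureRank M s' t := by
  rw [structureRank_of_le M ht, structureRank_of_le M (h.trans ht), ← structureMap_comp M h ht,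
    LinearMap.range_comp_of_range_eq_top _ (LinearMap.range_eq_top.2 (hF h hx).2)]

theorem ChangesOnlyAt.structureRank_right (hF : ChangesOnlyAt M F) {s t t' : ℝ} (hs : s ≤ t)
    (h : t ≤ t') (hx : ∀ x ∈ F, ¬ (t < x ∧ x ≤ t')) :
    structureRank M s t = structureRank M s t' := by
  rw [structureRank_of_le M hs, structureRank_of_le M (hs.trans h), ← structureMap_comp M hs h,
    LinearMap.range_comp, (Submodule.equivMapOfInjective _ (hF h hx).1 _).finrank_eq]

theorem classesDeadAt_coe {b d : ℝ} (h : b ≤ d) :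
    classesDeadAt M b (d : WithTop ℝ) = LinearMap.ker (structureMap M h) :=
  iSup_pos h

theorem classesDeadAt_mono {b : ℝ} {d d' : ℝ} (h : d ≤ d') :
    classesDeadAt M b (d : WithTop ℝ) ≤ classesDeadAt M b (d' : WithTop ℝ) := by
  refine iSup_le fun hb => ?_
  rw [classesDeadAt_coe (hb.trans h)]
  change LinearMap.ker (structureMap M hb) ≤ _
  rw [← structureMap_comp M hb h]
  exact LinearMap.ker_le_ker_comp _ _

theorem ChangesOnlyAt.olderClasses_eq (hF : ChangesOnlyAt M F) {e b : ℝ} (he : e < b)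
    (hx : ∀ x ∈ F, ¬ (e ≤ x ∧ x < b)) :
    olderClasses M b = LinearMap.range (structureMap M he.le) := by
  refine le_antisymm (iSup₂_le fun s hs => ?_) (le_iSup₂_of_le e he le_rfl)
  change LinearMap.range (structureMap M hs.le) ≤ _
  obtain h | h := le_total s e
  · rw [← structureMap_comp M h he.le]
    exact LinearMap.range_comp_le_range _ _
  · rw [← structureMap_comp M h hs.le, LinearMap.range_comp_of_range_eq_top]
    exact LinearMap.range_eq_top.2 (hF h fun x hxF hx' =>
      hx x hxF ⟨hx'.1.le, hx'.2.trans_lt hs⟩).2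

theorem ChangesOnlyAt.classesDeadBefore_eq (hF : ChangesOnlyAt M F) {b c d : ℝ} (hb : b ≤ c)
    (hc : c < d) (hx : ∀ x ∈ F, ¬ (c ≤ x ∧ x < d)) :
    classesDeadBefore M b (d : WithTop ℝ) = LinearMap.ker (structureMap M hb) := by
  rw [← classesDeadAt_coe hb]
  refine le_antisymm (iSup₂_le fun t ht => ?_)
    (le_iSup₂_of_le (f := fun (t : ℝ) (_ : (t : WithTop ℝ) < d) => classesDeadAt M b t) c
      (WithTop.coe_lt_coe.2 hc) le_rfl)
  have ht : t < d := WithTop.coe_lt_coe.1 ht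
  obtain h | h := le_total t c
  · exact classesDeadAt_mono h
  · rw [classesDeadAt_coe hb, classesDeadAt_coe (hb.trans h), ← structureMap_comp M hb h,
      LinearMap.ker_comp_of_ker_eq_bot]
    exact LinearMap.ker_eq_bot.2 (hF h fun x hxF hx' =>
      hx x hxF ⟨hx'.1.le, hx'.2.trans_lt ht⟩).1

/-- The condition says that the quotient defining the multiplicity is zero. -/
theorem barcode_eq_zero_of_le {b : ℝ} {d : WithTop ℝ}
    (h : classesDeadAt M b d ≤ (olderClasses M b ⊓ classesDeadAt M b d) ⊔
      classesDeadBefore M b d) : barcode M (b, d) = 0 := by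
  have h' := Submodule.submoduleOf_eq_top.2 h
  have := Submodule.Quotient.subsingleton_iff.2 h'
  exact finrank_zero_of_subsingleton

/-- The multiplicity of `[b, d)` is the mixed second difference of the rank function. The points `e`
and `c` stand for the left limits at `b` and `d`. -/
theorem ChangesOnlyAt.barcode_eq (hF : ChangesOnlyAt M F)
    [∀ α, FiniteDimensional (ZMod 2) (M.obj α)] {e b c d : ℝ}
    (he : e < b) (hex : ∀ x ∈ F, ¬ (e ≤ x ∧ x < b)) (hb : b ≤ c)
    (hc : c < d) (hcx : ∀ x ∈ F, ¬ (c ≤ x ∧ x < d)) :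
    (barcode M (b, (d : WithTop ℝ)) : ℤ) =
      (structureRank M e d - structureRank M e c) -
        (structureRank M b d - structureRank M b c) := by
  have hbd : b ≤ d := hb.trans hc.le
  have hK : LinearMap.ker (structureMap M hb) ≤ LinearMap.ker (structureMap M hbd) := by
    rw [← structureMap_comp M hb hc.le]
    exact LinearMap.ker_le_ker_comp _ _
  have hquot := Submodule.finrank_quotient_add_finrank
    (((LinearMap.range (structureMap M he.le) ⊓ LinearMap.ker (structureMap M hbd)) ⊔
      LinearMap.ker (structureMap M hb)).submoduleOf (LinearMap.ker (structureMap M hbd)))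
  have hsub := (Submodule.submoduleOfEquivOfLe (sup_le
    (inf_le_right (a := LinearMap.range (structureMap M he.le))) hK)).finrank_eq
  have hsup := Submodule.finrank_sup_add_finrank_inf_eq
    (LinearMap.range (structureMap M he.le) ⊓ LinearMap.ker (structureMap M hbd))
    (LinearMap.ker (structureMap M hb))
  rw [inf_assoc, inf_eq_right.2 hK] at hsup
  have h1 := finrank_range_inf_ker_add (structureMap M he.le) (structureMap M hbd)
  have h2 := finrank_range_inf_ker_add (structureMap M he.le) (structureMap M hb)
  have h3 := (structureMap M hbd).finrank_range_add_finrank_ker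
  have h4 := (structureMap M hb).finrank_range_add_finrank_ker
  rw [structureMap_comp] at h1 h2
  rw [structureRank_of_le M (he.le.trans hbd), structureRank_of_le M (he.le.trans hb),
    structureRank_of_le M hbd, structureRank_of_le M hb]
  simp only [barcode]
  rw [hF.olderClasses_eq he hex, hF.classesDeadBefore_eq hb hc hcx, classesDeadAt_coe hbd]
  omega

/-! ### The total length of a barcode is the integral of the dimension -/

/-- Bars are born and die only where the module changes: if `b ∉ F`, all classes at `b` are older,
and if `d ∉ F`, all classes dead at `d` have died before. -/
theorem ChangesOnlyAt.mem_of_barcode_ne_zero (hF : ChangesOnlyAt M F) {b d : ℝ} (hbd : b < d)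
    (h : barcode M (b, (d : WithTop ℝ)) ≠ 0) : b ∈ F ∧ d ∈ F := by
  constructor
  · by_contra hb
    refine h (barcode_eq_zero_of_le (le_sup_of_le_left (le_inf ?_ le_rfl)))
    obtain ⟨e, he, hex⟩ := exists_lt_forall_not_mem_Ico F b
    rw [hF.olderClasses_eq he hex, LinearMap.range_eq_top.2]
    · exact le_top
    · refine (hF he.le fun x hx h' => ?_).2
      obtain h'' | rfl := h'.2.lt_or_eq
      · exact hex x hx ⟨h'.1.le, h''⟩
      · exact hb hx
  · by_contra hd
    refine h (barcode_eq_zero_of_le (le_sup_of_le_right ?_))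
    obtain ⟨c, hc, hcx⟩ := exists_lt_forall_not_mem_Ico F d
    have hm : max b c < d := max_lt hbd hc
    rw [hF.classesDeadBefore_eq (le_max_left b c) hm fun x hx h' =>
        hcx x hx ⟨(le_max_right _ _).trans h'.1, h'.2⟩, classesDeadAt_coe hbd.le,
      ← structureMap_comp M (le_max_left b c) hm.le, LinearMap.ker_comp_of_ker_eq_bot]
    refine LinearMap.ker_eq_bot.2 (hF hm.le fun x hx h' => ?_).1
    obtain h'' | rfl := h'.2.lt_or_eq
    · exact hcx x hx ⟨(le_max_right _ _).trans h'.1.le, h''⟩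
    · exact hd hx

/-- No bar is infinite if the module vanishes eventually. -/
theorem barcode_top_eq_zero {T : ℝ} (hT : ∀ t, T ≤ t → Subsingleton (M.obj t)) (b : ℝ) :
    barcode M (b, ⊤) = 0 := by
  refine barcode_eq_zero_of_le (le_sup_of_le_right
    (le_iSup₂_of_le (f := fun (t : ℝ) (_ : (t : WithTop ℝ) < ⊤) => classesDeadAt M b t) (max b T)
      (WithTop.coe_lt_top _) ?_))
  rw [classesDeadAt_coe (le_max_left b T)]
  intro x _
  have := hT _ (le_max_right b T)
  exact Subsingleton.elim _ _

theorem structureRank_eq_zero_of_subsingleton {s t : ℝ}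
    (h : Subsingleton (M.obj s) ∨ Subsingleton (M.obj t)) : structureRank M s t = 0 := by
  rw [structureRank]
  split_ifs with hst
  · rw [Nat.cast_eq_zero]
    have : LinearMap.range (structureMap M hst) = ⊥ := by
      rw [LinearMap.range_eq_bot]
      obtain h | h := h
      · exact Subsingleton.elim _ _
      · exact Subsingleton.elim _ _
    rw [this, finrank_bot]
  · rfl

/-- The dimension of `M_α` is the number of bars that contain `α`: the second differences of the
rank function telescope in both variables. -/
theorem ChangesOnlyAt.sum_barcode_eq_finrank (hF : ChangesOnlyAt M F)
    [∀ α, FiniteDimensional (ZMod 2) (M.obj α)] {S T : ℝ}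
    (hS : ∀ s, s < S → Subsingleton (M.obj s)) (hT : ∀ t, T ≤ t → Subsingleton (M.obj t)) (α : ℝ) :
    ∑ b ∈ F with b ≤ α, ∑ d ∈ F with α < d, barcode M (b, (d : WithTop ℝ)) =
      finrank (ZMod 2) (M.obj α) := by
  choose p hpb hp using exists_lt_forall_not_mem_Ico F
  obtain ⟨t, ht⟩ := F.bddAbove
  obtain ⟨s, hs⟩ := F.bddBelow
  -- The module vanishes at `s'` and at `t'`, and all changes happen between them.
  set t' : ℝ := max (max T α) t
  set s' : ℝ := min (min (S - 1) α) (s - 1)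
  have hαt : α ≤ t' := (le_max_right _ _).trans (le_max_left _ _)
  have hsα : s' ≤ α := (min_le_left _ _).trans (min_le_right _ _)
  have hTt : Subsingleton (M.obj t') := hT _ ((le_max_left _ _).trans (le_max_left _ _))
  have hSs : Subsingleton (M.obj s') := hS _ (by
    have : s' ≤ S - 1 := (min_le_left _ _).trans (min_le_left _ _)
    linarith)
  have hFt : ∀ x ∈ F, x ≤ t' := fun x hx => (ht hx).trans (le_max_right _ _)
  have hFs : ∀ x ∈ F, s' < x := fun x hx => by
    have h1 : s ≤ x := hs hx
    have h2 : s' ≤ s - 1 := min_le_right _ _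
    linarith
  -- Telescoping in the death coordinate, for births at `b` and just before `b`.
  have key : ∀ b ∈ F, b ≤ α → ∀ e ≤ b,
      ∑ d ∈ F with α < d, (structureRank M e d - structureRank M e (p d)) =
        - structureRank M e α := by
    intro b hb hbα e he
    have := sum_jumps_eq_sub F p hpb hp (Set.Ici b) (structureRank M e)
      (fun u hu v _ huv hx => hF.structureRank_right (he.trans hu) huv hx) α t' hαt hbα
      (hbα.trans hαt) (fun d _ hαd _ => ⟨hbα.trans hαd.le, by
        by_contra h
        exact hp d b hb ⟨(not_le.1 h).le, hbα.trans_lt hαd⟩⟩)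
    rw [structureRank_eq_zero_of_subsingleton (Or.inr hTt), zero_sub] at this
    rw [← this]
    refine Finset.sum_congr (Finset.filter_congr fun x hx => ?_) fun _ _ => rfl
    simp [hFt x hx]
  -- Telescoping in the birth coordinate.
  have outer := sum_jumps_eq_sub F p hpb hp (Set.Iic α) (fun u => structureRank M u α)
      (fun u _ v hv huv hx => hF.structureRank_left huv hv hx) s' α hsα hsα (Set.mem_Iic.2 le_rfl)
      (fun b _ _ hbα => ⟨hbα, (hpb b).le.trans hbα⟩)
  rw [structureRank_eq_zero_of_subsingleton (Or.inl hSs), structureRank_self, sub_zero] at outer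
  rw [← Nat.cast_inj (R := ℤ), ← outer]
  push_cast
  refine Finset.sum_congr (Finset.filter_congr fun x hx => by simp [hFs x hx]) fun b hb => ?_
  obtain ⟨hbF, -, hbα⟩ := Finset.mem_filter.1 hb
  calc ∑ d ∈ F with α < d, (barcode M (b, (d : WithTop ℝ)) : ℤ)
      = ∑ d ∈ F with α < d, ((structureRank M (p b) d - structureRank M (p b) (p d)) -
          (structureRank M b d - structureRank M b (p d))) := by
        refine Finset.sum_congr rfl fun d hd => ?_
        have hbd : b < d := hbα.trans_lt (Finset.mem_filter.1 hd).2
        exact hF.barcode_eq (hpb b) (hp b)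
          (not_lt.1 fun h => hp d b hbF ⟨h.le, hbd⟩) (hpb d) (hp d)
    _ = structureRank M b α - structureRank M (p b) α := by
        rw [Finset.sum_sub_distrib, key b hbF hbα _ (hpb b).le, key b hbF hbα b le_rfl]
        ring

/-- The length of `[b, d)` is the integral of its indicator function, so the total length is the
integral of the number of bars containing `α`. -/
theorem ChangesOnlyAt.totalLength_barcode (hF : ChangesOnlyAt M F)
    [∀ α, FiniteDimensional (ZMod 2) (M.obj α)] {S T : ℝ}
    (hS : ∀ s, s < S → Subsingleton (M.obj s)) (hT : ∀ t, T ≤ t → Subsingleton (M.obj t)) :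
    totalLength (barcode M) = ∫⁻ α, (finrank (ZMod 2) (M.obj α) : ℝ≥0∞) := by
  have h0 : ∀ α, (finrank (ZMod 2) (M.obj α) : ℝ≥0∞) = ∑ I ∈ F ×ˢ F,
      (Set.Ico I.1 I.2).indicator (fun _ => (barcode M (I.1, (I.2 : WithTop ℝ)) : ℝ≥0∞)) α := by
    intro α
    rw [← hF.sum_barcode_eq_finrank hS hT α, Finset.sum_product, Finset.sum_filter]
    push_cast
    refine Finset.sum_congr rfl fun b _ => ?_
    split_ifs with h
    · rw [Finset.sum_filter]
      refine Finset.sum_congr rfl fun d _ => ?_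
      simp [Set.indicator_apply, h]
    · symm
      refine Finset.sum_eq_zero fun d _ => ?_
      simp [h]
  simp_rw [h0]
  rw [lintegral_finsetSum _ fun I _ => measurable_const.indicator measurableSet_Ico, totalLength,
    tsum_eq_sum (s := (F ×ˢ F).map ⟨fun I : ℝ × ℝ => (I.1, (I.2 : WithTop ℝ)), ?_⟩)]
  · rw [Finset.sum_map]
    refine Finset.sum_congr rfl fun I _ => ?_
    rw [lintegral_indicator_const measurableSet_Ico, Real.volume_Ico]
    rfl
  · rintro ⟨b, d⟩ hI
    induction d using WithTop.recTopCoe with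
    | top => rw [barcode_top_eq_zero hT, Nat.cast_zero, zero_mul]
    | coe d =>
      rw [mul_eq_zero, or_iff_not_imp_right]
      intro hlen
      have hbd : b < d := by
        by_contra h
        exact hlen (ENNReal.ofReal_eq_zero.2 (by linarith))
      by_contra hne
      refine hI (Finset.mem_map.2 ⟨(b, d), Finset.mem_product.2
        (hF.mem_of_barcode_ne_zero hbd fun h => hne (by rw [h, Nat.cast_zero])), rfl⟩)
  · rintro ⟨b, d⟩ ⟨b', d'⟩ h
    simpa using h

/-! ### Homology of Vietoris-Rips complexes -/

section VietorisRips

variable {V : Type} (m : V → V → WithTop ℝ) (k : ℕ)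

theorem chains_succ_eq_bot {α : ℝ} (h : ∀ i, (α : WithTop ℝ) < m i i) :
    chains m (k + 1) α = ⊥ := by
  refine (Submodule.eq_bot_iff _).2 fun x hx => funext fun σ => hx σ fun hσ => ?_
  obtain ⟨i, hi⟩ := Finset.card_pos.1 (hσ.2.symm ▸ k.succ_pos : 0 < σ.card)
  exact not_le.2 (h i) (hσ.1 i hi i hi)

theorem chains_le_chains_add {m m' : V → V → WithTop ℝ} {ε : ℝ}
    (h : ∀ i j, m' i j ≤ m i j + (ε : WithTop ℝ)) (n : ℕ) (α : ℝ) :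
    chains m n α ≤ chains m' n (α + ε) := fun x hx σ hσ => hx σ fun hσ' =>
  hσ ⟨fun i hi j hj => (h i j).trans <| by
    rw [WithTop.coe_add]
    exact add_le_add_left (hσ'.1 i hi j hj) _, hσ'.2⟩

variable [Fintype V] [DecidableEq V]

/-- The boundary in coordinates: the coefficient at `τ` collects those of all cofaces of `τ`. -/
theorem boundary_apply (x : Finset V → ZMod 2) (τ : Finset V) :
    boundary V x τ = ∑ v ∈ τᶜ, x (insert v τ) := by
  have h (σ : Finset V) : (∑ v ∈ σ, Pi.single (M := fun _ : Finset V => ZMod 2) (σ.erase v) 1) τ =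
      ∑ v : V, if v ∉ τ ∧ σ = insert v τ then 1 else 0 := by
    rw [Finset.sum_apply, ← Finset.sum_subset (Finset.subset_univ σ)]
    · refine Finset.sum_congr rfl fun v hv => ?_
      rw [Pi.single_apply]
      refine if_congr ⟨?_, ?_⟩ rfl rfl
      · rintro rfl
        exact ⟨Finset.notMem_erase v σ, (Finset.insert_erase hv).symm⟩
      · rintro ⟨hvτ, rfl⟩
        exact (Finset.erase_insert hvτ).symm
    · rintro v - hv
      refine if_neg ?_
      rintro ⟨-, rfl⟩
      exact hv (Finset.mem_insert_self v τ)
  rw [boundary, Fintype.linearCombination_apply, Finset.sum_apply]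
  simp_rw [Pi.smul_apply, h, smul_eq_mul, Finset.mul_sum]
  rw [Finset.sum_comm, ← Finset.sum_subset (Finset.subset_univ τᶜ)]
  · refine Finset.sum_congr rfl fun v hv => ?_
    simp [Finset.mem_compl.1 hv]
  · intro v _ hv
    simp [Finset.notMem_compl.1 hv]

/-- The complex is a cone if some vertex `c` is joined to all others; its cycles then bound, being
the boundaries of their joins with `c`. -/
theorem cycles_le_boundaries_of_apex {α : ℝ} (c : V) (hc : ∀ j, m c j ≤ α) (hc' : ∀ j, m j c ≤ α) :
    cycles m k α ≤ boundaries m k α := by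
  rintro x ⟨hx, hx0⟩
  refine ⟨fun τ => if c ∈ τ then x (τ.erase c) else 0, ?_, ?_⟩
  · intro τ hτ
    change (if c ∈ τ then x (τ.erase c) else 0) = 0
    split_ifs with hcτ
    · refine hx _ fun h => hτ ⟨fun i hi j hj => ?_, ?_⟩
      · by_cases hic : i = c
        · exact hic ▸ hc j
        by_cases hjc : j = c
        · exact hjc ▸ hc' i
        exact h.1 i (Finset.mem_erase.2 ⟨hic, hi⟩) j (Finset.mem_erase.2 ⟨hjc, hj⟩)
      · rw [← Finset.card_erase_add_one hcτ, h.2]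
    · rfl
  · funext τ
    rw [boundary_apply]
    by_cases hcτ : c ∈ τ
    · -- The sum is the coefficient of the boundary of `x` at `τ.erase c`, but for the term `x τ`.
      have hb : boundary V x (τ.erase c) = 0 := congrFun hx0 _
      rw [boundary_apply, Finset.compl_erase, Finset.sum_insert (by simpa using hcτ),
        Finset.insert_erase hcτ] at hb
      rw [CharTwo.add_eq_zero.1 hb]
      refine Finset.sum_congr rfl fun v hv => ?_
      have hvc : v ≠ c := fun h => Finset.mem_compl.1 hv (h ▸ hcτ)
      rw [if_pos (Finset.mem_insert_of_mem hcτ), Finset.erase_insert_of_ne hvc]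
    · rw [Finset.sum_eq_single c]
      · rw [if_pos (Finset.mem_insert_self c τ), Finset.erase_insert hcτ]
      · intro v _ hvc
        exact if_neg fun h => (Finset.mem_insert.1 h).elim (fun h => hvc h.symm) hcτ
      · intro h
        exact absurd (Finset.mem_compl.2 hcτ) h

theorem subsingleton_homology_of_le {α : ℝ} (h : cycles m k α ≤ boundaries m k α) :
    Subsingleton (homology m k α) :=
  Submodule.Quotient.subsingleton_iff.2 (Submodule.submoduleOf_eq_top.2 h)

/-- Both terms on the right are increasing in `α`. Boundaries are cycles, but with the intersection
this need not be known. -/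
theorem finrank_homology (α : ℝ) :
    (finrank (ZMod 2) (homology m k α) : ℝ) = finrank (ZMod 2) (cycles m k α) -
      finrank (ZMod 2) ↥(cycles m k α ⊓ boundaries m k α) := by
  rw [eq_sub_iff_add_eq, ← Nat.cast_add, Nat.cast_inj,
    ← ((boundaries m k α).submoduleOf (cycles m k α)).finrank_quotient_add_finrank,
    ← Submodule.map_comap_subtype]
  exact congrArg _
    (Submodule.equivMapOfInjective _ (cycles m k α).injective_subtype _).finrank_eq.symm

/-- The finite weights of the graph; an infinite weight contributes the harmless value `0`. -/
noncomputable def finiteWeights : Finset ℝ :=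
  Finset.univ.image fun e : V × V => (m e.1 e.2).untopD 0

theorem changesOnlyAt_persistentHomology :
    ChangesOnlyAt (persistentHomology m k) (finiteWeights m) := by
  intro s t h hx
  have hchains (n : ℕ) : chains m n t ≤ chains m n s := by
    refine fun x hx' σ hσ => hx' σ fun hσ' => hσ ⟨fun i hi j hj => ?_, hσ'.2⟩
    have hij := hσ'.1 i hi j hj
    obtain ⟨r, hr⟩ := WithTop.ne_top_iff_exists.1 (ne_top_of_le_ne_top WithTop.coe_ne_top hij)
    have hrF : r ∈ finiteWeights m :=
      Finset.mem_image.2 ⟨(i, j), Finset.mem_univ _, by rw [← hr, WithTop.untopD_coe]⟩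
    rw [← hr, WithTop.coe_le_coe] at hij ⊢
    exact not_lt.1 fun hsr => hx r hrF ⟨hsr, hij⟩
  change Function.Bijective (homologyMap m k h)
  constructor
  · refine (injective_iff_map_eq_zero _).2 fun x hx0 => ?_
    obtain ⟨x, rfl⟩ := Submodule.Quotient.mk_surjective _ x
    have hx' : Submodule.inclusion (cycles_mono m k h) x ∈
        (boundaries m k t).submoduleOf (cycles m k t) := (Submodule.Quotient.mk_eq_zero _).1 hx0
    exact (Submodule.Quotient.mk_eq_zero _).2 (Submodule.map_mono (hchains (k + 2)) hx')
  · intro y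
    obtain ⟨y, rfl⟩ := Submodule.Quotient.mk_surjective _ y
    exact ⟨Submodule.Quotient.mk ⟨y, inf_le_inf_right _ (hchains (k + 1)) y.2⟩, rfl⟩

instance (α : ℝ) : FiniteDimensional (ZMod 2) ((persistentHomology m k).obj α) :=
  inferInstanceAs (FiniteDimensional (ZMod 2) (homology m k α))

end VietorisRips

/-! ### Integrals of dimensions -/

/-- Shifting `g` by `ε` replaces `[a, b]` by `[a + ε, b + ε]`, which gains at most `ε * C` at the
right end. -/
theorem integral_le_integral_add_of_shift {f g : ℝ → ℝ} (hf : Monotone f) (hg : Monotone g)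
    {C ε a b : ℝ} (hg0 : ∀ x, 0 ≤ g x) (hgC : ∀ x, g x ≤ C) (hε : 0 ≤ ε) (hab : a ≤ b)
    (hfg : ∀ x, f x ≤ g (x + ε)) : ∫ x in a..b, f x ≤ (∫ x in a..b, g x) + ε * C := by
  have hi (u v : ℝ) : IntervalIntegrable g volume u v := hg.intervalIntegrable
  have hg' : Monotone fun x => g (x + ε) := fun x y h => hg (by linarith)
  have h1 := intervalIntegral.integral_mono hab hf.intervalIntegrable (μ := volume)
    (hg'.intervalIntegrable) hfg
  rw [intervalIntegral.integral_comp_add_right] at h1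
  have h2 := intervalIntegral.integral_add_adjacent_intervals (hi a (a + ε)) (hi (a + ε) (b + ε))
  have h3 := intervalIntegral.integral_add_adjacent_intervals (hi a b) (hi b (b + ε))
  have h4 : 0 ≤ ∫ x in a..(a + ε), g x :=
    intervalIntegral.integral_nonneg (by linarith) fun x _ => hg0 x
  have h5 := intervalIntegral.integral_mono (by linarith : b ≤ b + ε) (hi b (b + ε))
    (intervalIntegrable_const (c := C) (μ := volume)) hgC
  rw [intervalIntegral.integral_const, smul_eq_mul, add_sub_cancel_left] at h5
  linarith

/-- The integral over `[a, b]` of the dimensions of the members of a filtration by subspaces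
depends continuously on the filtration, for the interleaving distance. -/
theorem continuous_integral_finrank {P K W : Type*} [TopologicalSpace P] [DivisionRing K]
    [AddCommGroup W] [Module K W] [FiniteDimensional K W] (G : P → ℝ → Submodule K W)
    (hG : ∀ p, Monotone (G p))
    (hclose : ∀ p, ∀ ε > 0, ∀ᶠ q in nhds p, ∀ α, G p α ≤ G q (α + ε) ∧ G q α ≤ G p (α + ε))
    {a b : ℝ} (hab : a ≤ b) :
    Continuous fun p => ∫ α in a..b, (finrank K (G p α) : ℝ) := by
  have hmono (p : P) : Monotone fun α => (finrank K (G p α) : ℝ) := fun x y h =>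
    Nat.cast_le.2 (Submodule.finrank_mono (hG p h))
  set C : ℝ := (finrank K W : ℝ)
  have hC (p : P) (α : ℝ) : (finrank K (G p α) : ℝ) ≤ C := Nat.cast_le.2 (Submodule.finrank_le _)
  refine continuous_iff_continuousAt.2 fun p => Metric.tendsto_nhds.2 fun δ hδ => ?_
  have hC0 : 0 ≤ C := Nat.cast_nonneg _
  have hε : 0 < δ / (C + 1) := by positivity
  have hlt : δ / (C + 1) * C < δ := by
    rw [div_mul_eq_mul_div, div_lt_iff₀ (by linarith)]
    linarith
  filter_upwards [hclose p _ hε] with q hq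
  have h1 := integral_le_integral_add_of_shift (hmono p) (hmono q) (fun _ => Nat.cast_nonneg _)
    (hC q) hε.le hab fun α => Nat.cast_le.2 (Submodule.finrank_mono (hq α).1)
  have h2 := integral_le_integral_add_of_shift (hmono q) (hmono p) (fun _ => Nat.cast_nonneg _)
    (hC p) hε.le hab fun α => Nat.cast_le.2 (Submodule.finrank_mono (hq α).2)
  rw [Real.dist_eq, abs_lt]
  constructor <;> linarith

/-! ### Pairs of point clouds -/

section PointClouds

variable {N : ℕ} {E E' : Type*} [MetricSpace E] [MetricSpace E']

theorem doubledWeights_le_add {w v w' v' : Fin N → Fin N → ℝ} {ε : ℝ} (hε : 0 ≤ ε)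
    (h : ∀ i j, w i j ≤ v i j + ε) (h' : ∀ i j, w' i j ≤ v' i j + ε) (i j : Fin N ⊕ Fin N) :
    doubledWeights w w' i j ≤ doubledWeights v v' i j + (ε : WithTop ℝ) := by
  have hup (i j : Fin N) : upperPart w i j ≤ upperPart v i j + (ε : WithTop ℝ) := by
    unfold upperPart
    split_ifs
    · exact_mod_cast h i j
    · simp
  rcases i with i | i <;> rcases j with j | j
  · change (0 : WithTop ℝ) ≤ 0 + (ε : WithTop ℝ)
    rw [zero_add]
    exact_mod_cast hε
  · exact hup j i
  · exact hup i j
  · change ((min (w i j) (w' i j) : ℝ) : WithTop ℝ) ≤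
      ((min (v i j) (v' i j) : ℝ) : WithTop ℝ) + (ε : WithTop ℝ)
    rw [← WithTop.coe_add, WithTop.coe_le_coe, ← min_add_add_right]
    exact min_le_min (h i j) (h' i j)

theorem doubledWeights_distMatrix_self (X : Fin N → E) (Y : Fin N → E') (i : Fin N ⊕ Fin N) :
    doubledWeights (distMatrix X) (distMatrix Y) i i = 0 := by
  rcases i with i | i
  · rfl
  · simp [doubledWeights, distMatrix]

theorem subsingleton_homology_of_neg (k : ℕ) (X : Fin N → E) (Y : Fin N → E') {α : ℝ}
    (hα : α < 0) :
    Subsingleton (homology (doubledWeights (distMatrix X) (distMatrix Y)) k α) := by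
  refine subsingleton_homology_of_le _ k (inf_le_left.trans ?_)
  rw [chains_succ_eq_bot _ k fun i => ?_]
  · exact bot_le
  · rw [doubledWeights_distMatrix_self]
    exact_mod_cast hα

/-- Beyond the diameter of `X` the complex is a cone: the first copy of the last point is
joined to all vertices, as its row in `w₊ᵀ` has no infinite entry. -/
theorem subsingleton_homology_of_dist_le (k : ℕ) (X : Fin N → E) (Y : Fin N → E') {α : ℝ}
    (hα : 0 ≤ α) (hX : ∀ i j, dist (X i) (X j) ≤ α) :
    Subsingleton (homology (doubledWeights (distMatrix X) (distMatrix Y)) k α) := by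
  refine subsingleton_homology_of_le _ k ?_
  cases N with
  | zero =>
    refine inf_le_left.trans ?_
    rw [chains_succ_eq_bot _ k fun i => isEmptyElim i]
    exact bot_le
  | succ N =>
    have hup (j : Fin (N + 1)) : upperPart (distMatrix X) j (Fin.last N) ≤ (α : WithTop ℝ) := by
      rw [upperPart, if_pos (Fin.le_last j)]
      exact WithTop.coe_le_coe.2 (hX _ _)
    have h0 : (0 : WithTop ℝ) ≤ α := by exact_mod_cast hα
    exact cycles_le_boundaries_of_apex _ k (Sum.inl (Fin.last N))
      (Sum.rec (fun _ => h0) hup) (Sum.rec (fun _ => h0) hup)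

/-- `RTD_k` as an integral of dimensions of homology groups, over an interval that contains all
bars. -/
theorem rtd_eq_ofReal_integral (k : ℕ) (X : Fin N → E) (Y : Fin N → E') {R : ℝ} (hR : 0 ≤ R)
    (hX : ∀ i j, dist (X i) (X j) ≤ R) :
    rtd k X Y = ENNReal.ofReal (∫ α in (-1)..R, (finrank (ZMod 2)
      (homology (doubledWeights (distMatrix X) (distMatrix Y)) k α) : ℝ)) := by
  set m := doubledWeights (distMatrix X) (distMatrix Y)
  have hS (s : ℝ) (hs : s < 0) : Subsingleton (homology m k s) :=
    subsingleton_homology_of_neg k X Y hs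
  have hT (t : ℝ) (ht : R ≤ t) : Subsingleton (homology m k t) :=
    subsingleton_homology_of_dist_le k X Y (hR.trans ht) fun i j => (hX i j).trans ht
  have hsupp : Function.support (fun α => (finrank (ZMod 2) (homology m k α) : ℝ≥0∞)) ⊆
      Set.Ioc (-1) R := by
    intro α hα
    by_contra h
    refine hα (Nat.cast_eq_zero.2 ?_)
    obtain h' | h' := lt_or_ge α 0
    · have := hS α h'
      exact finrank_zero_of_subsingleton
    · have := hT α (not_lt.1 fun h'' => h ⟨by linarith, h''.le⟩)
      exact finrank_zero_of_subsingleton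
  have hint : IntervalIntegrable (fun α => (finrank (ZMod 2) (homology m k α) : ℝ)) volume
      (-1) R := by
    simp_rw [finrank_homology]
    refine IntervalIntegrable.sub (Monotone.intervalIntegrable ?_) (Monotone.intervalIntegrable ?_)
    · exact fun x y h => Nat.cast_le.2 (Submodule.finrank_mono (cycles_mono m k h))
    · exact fun x y h => Nat.cast_le.2 (Submodule.finrank_mono
        (inf_le_inf (cycles_mono m k h) (boundaries_mono m k h)))
  rw [intervalIntegral.integral_of_le (by linarith),
    ofReal_integral_eq_lintegral_ofReal hint.1 (Filter.Eventually.of_forall fun _ =>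
      Nat.cast_nonneg _)]
  simp_rw [ENNReal.ofReal_natCast]
  rw [← lintegral_indicator measurableSet_Ioc, Set.indicator_eq_self.2 hsupp]
  exact (changesOnlyAt_persistentHomology m k).totalLength_barcode hS hT

/-- If the distances change by less than `ε`, the cycles and the boundaries are `ε`-interleaved. -/
theorem continuous_integral_finrank_homology (k : ℕ) {a b : ℝ} (hab : a ≤ b) :
    Continuous fun p : (Fin N → E) × (Fin N → E') => ∫ α in a..b, (finrank (ZMod 2)
      (homology (doubledWeights (distMatrix p.1) (distMatrix p.2)) k α) : ℝ) := by
  set m := fun p : (Fin N → E) × (Fin N → E') =>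
    doubledWeights (distMatrix p.1) (distMatrix p.2)
  have hclose (p : (Fin N → E) × (Fin N → E')) (ε : ℝ) (hε : 0 < ε) :
      ∀ᶠ q in nhds p, ∀ n α, chains (m p) n α ≤ chains (m q) n (α + ε) ∧
        chains (m q) n α ≤ chains (m p) n (α + ε) := by
    have h1 : ∀ᶠ q in nhds p, ∀ i j, dist (dist (q.1 i) (q.1 j)) (dist (p.1 i) (p.1 j)) < ε :=
      Filter.eventually_all.2 fun i => Filter.eventually_all.2 fun j =>
        Metric.tendsto_nhds.1 (Continuous.tendsto (by fun_prop) p) ε hε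
    have h2 : ∀ᶠ q in nhds p, ∀ i j, dist (dist (q.2 i) (q.2 j)) (dist (p.2 i) (p.2 j)) < ε :=
      Filter.eventually_all.2 fun i => Filter.eventually_all.2 fun j =>
        Metric.tendsto_nhds.1 (Continuous.tendsto (by fun_prop) p) ε hε
    have hle {x y : ℝ} (h : dist x y < ε) : x ≤ y + ε ∧ y ≤ x + ε := by
      obtain ⟨h, h'⟩ := abs_lt.1 (Real.dist_eq x y ▸ h)
      constructor <;> linarith
    filter_upwards [h1, h2] with q hq1 hq2 n α
    exact ⟨chains_le_chains_add (doubledWeights_le_add hε.le (fun i j => (hle (hq1 i j)).1)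
        fun i j => (hle (hq2 i j)).1) n α,
      chains_le_chains_add (doubledWeights_le_add hε.le (fun i j => (hle (hq1 i j)).2)
        fun i j => (hle (hq2 i j)).2) n α⟩
  have hZ := continuous_integral_finrank (fun p α => cycles (m p) k α)
    (fun p _ _ h => cycles_mono (m p) k h)
    (fun p ε hε => (hclose p ε hε).mono fun q hq α =>
      ⟨inf_le_inf_right _ (hq _ α).1, inf_le_inf_right _ (hq _ α).2⟩) hab
  have hB := continuous_integral_finrank (fun p α => cycles (m p) k α ⊓ boundaries (m p) k α)
    (fun p _ _ h => inf_le_inf (cycles_mono (m p) k h) (boundaries_mono (m p) k h))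
    (fun p ε hε => (hclose p ε hε).mono fun q hq α =>
      ⟨inf_le_inf (inf_le_inf_right _ (hq _ α).1) (Submodule.map_mono (hq _ α).1),
        inf_le_inf (inf_le_inf_right _ (hq _ α).2) (Submodule.map_mono (hq _ α).2)⟩) hab
  convert hZ.sub hB using 2 with p
  simp_rw [finrank_homology]
  refine intervalIntegral.integral_sub (Monotone.intervalIntegrable ?_)
    (Monotone.intervalIntegrable ?_)
  · exact fun x y h => Nat.cast_le.2 (Submodule.finrank_mono (cycles_mono (m p) k h))
  · exact fun x y h => Nat.cast_le.2 (Submodule.finrank_mono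
      (inf_le_inf (cycles_mono (m p) k h) (boundaries_mono (m p) k h)))

theorem exists_dist_lt (X : Fin N → E) : ∃ R : ℝ, 0 ≤ R ∧ ∀ i j, dist (X i) (X j) < R := by
  refine ⟨Metric.diam (Set.range X) + 1, by positivity, fun i j => ?_⟩
  have := Metric.dist_le_diam_of_mem (Set.finite_range X).isBounded (Set.mem_range_self i)
    (Set.mem_range_self j)
  linarith

theorem rtd_ne_top (k : ℕ) (X : Fin N → E) (Y : Fin N → E') : rtd k X Y ≠ ⊤ := by
  obtain ⟨R, hR, hX⟩ := exists_dist_lt X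
  rw [rtd_eq_ofReal_integral k X Y hR fun i j => (hX i j).le]
  exact ENNReal.ofReal_ne_top

theorem continuous_rtd (k : ℕ) :
    Continuous fun p : (Fin N → E) × (Fin N → E') => rtd k p.1 p.2 := by
  refine continuous_iff_continuousAt.2 fun p => ?_
  obtain ⟨R, hR, hX⟩ := exists_dist_lt p.1
  have hev : ∀ᶠ q : (Fin N → E) × (Fin N → E') in nhds p, ∀ i j, dist (q.1 i) (q.1 j) < R :=
    Filter.eventually_all.2 fun i => Filter.eventually_all.2 fun j =>
      (Continuous.tendsto (by fun_prop) p).eventually_lt_const (hX i j)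
  have hcont := ENNReal.continuous_ofReal.comp
    (continuous_integral_finrank_homology (N := N) (E := E) (E' := E') k
      (show (-1 : ℝ) ≤ R by linarith))
  refine hcont.continuousAt.congr ?_
  filter_upwards [hev] with q hq
  exact (rtd_eq_ofReal_integral k q.1 q.2 hR fun i j => (hq i j).le).symm

end PointClouds

end RTD

theorem mainTheorem3 {E E' : Type*} [MetricSpace E] [MetricSpace E'] (N : ℕ) :
    (∀ k : ℕ,
      (∀ (X : Fin N → E) (Y : Fin N → E'), RTD.rtd k X Y ≠ ⊤) ∧
      Continuous (fun p : (Fin N → E) × (Fin N → E') => RTD.rtd k p.1 p.2)) ∧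
    Continuous (fun p : (Fin N → E) × (Fin N → E') => RTD.rtdLoss p.1 p.2) := by
  refine ⟨fun k => ⟨RTD.rtd_ne_top k, RTD.continuous_rtd k⟩, ?_⟩
  have hsum := (RTD.continuous_rtd (N := N) (E := E) (E' := E') 1).add
    ((RTD.continuous_rtd (N := N) (E := E') (E' := E) 1).comp continuous_swap)
  exact (ENNReal.continuous_div_const 2 two_ne_zero).comp hsum
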